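/- **Theorem 3.3.** Let $\mathcal H$ be a complex Hilbert space with scalar product $\langle\cdot,\cdot\rangle$ (linear in the second variable) and let $q\in[-1,1]$. Put $\lambda_0=1$ on $\mathcal H^{\otimes 0}=\mathbb C$, $\lambda_1=1$ on $\mathcal H$, $\lambda_2(f\otimes g)=f\otimes g+q\,g\otimes f$ on $\mathcal H^{\otimes 2}$ and $\lambda_{n+2}=1_{\mathcal H}^{\otimes n}\otimes\lambda_2$ on $\mathcal H^{\otimes(n+2)}$ for $n\ge1$. Let $\mathcal H_n$ be the Hilbert space obtained from $\mathcal H^{\otimes n}$ with the positive semidefinite form $\langle F,\lambda_nG\rangle_{\otimes n}$, where $\langle\cdot,\cdot\rangle_{\otimes n}$ is the standard tensor scalar product, by dividing out the kernel and completing. The $(\mathbf q,2)$-Fock space over $\mathcal H$ is $\Gamma_{q,2}(\mathcal H)=\bigoplus_{n\ge0}\mathcal H_n$, with vacuum vector $\Phi=1\oplus0\oplus0\oplus\cdots$. For $f\in\mathcal H$ let $A^+(f)$ be the bounded creation operator determined by $A^+(f)\Phi=f$ and $A^+(f)F=f\otimes F$ for $F\in\mathcal H_n$, $n\ge1$; let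 $A(f)=A^+(f)^*$ and $Q(f)=A(f)+A^+(f)$. The distribution of $Q(f)^2$ is its distribution in the vacuum state, i.e. the Borel probability measure $\mu$ on $\mathbb R$ with $\int\varphi\,d\mu=\langle\Phi,\varphi(Q(f)^2)\Phi\rangle$ for every compactly supported continuous $\varphi:\mathbb R\to\mathbb R$. Let $q\in(-1,0)$, $a:=1+q\in(0,1)$, and let $f\in\mathcal H$ with $\|f\|=\tfrac12$. Then the distribution of $Q(f)^2$ is absolutely continuous with respect to Lebesgue measure, with probability density function $\frac{a}{8\pi(1-a)}\,g_a$, where $$g_a(x)=\begin{cases}\dfrac{\sqrt{1-x}}{\sqrt x\,h_a(x)}, & x\in(0,1),\\[2mm] 0, & x\notin(0,1),\end{cases}\qquad h_a(x)=x^2-\frac{a+2}{4}\,x-\frac{1}{16(a-1)}.$$ -/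

import Mathlib

open scoped TensorProduct InnerProductSpace

noncomputable section

namespace Q2Fock

universe u

/-! ### Algebraic tensor powers with the standard tensor scalar product -/

instance : InnerProductSpace ℂ (ULift.{u} ℂ) where
  inner x y := inner ℂ x.down y.down
  norm_sq_eq_re_inner x := norm_sq_eq_re_inner (𝕜 := ℂ) x.down
  conj_inner_symm x y := inner_conj_symm (𝕜 := ℂ) x.down y.down
  add_left x y z := inner_add_left (𝕜 := ℂ) x.down y.down z.down
  smul_left x y r := inner_smul_left (𝕜 := ℂ) x.down y.down r

/-- A complex inner product space, bundled with its structure. It serves only to define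
the tensor powers of a space together with their scalar products by recursion. -/
structure BundledIPS : Type (u + 1) where
  carrier : Type u
  [normed : NormedAddCommGroup carrier]
  [ips : InnerProductSpace ℂ carrier]

attribute [instance] BundledIPS.normed BundledIPS.ips

variable (H : Type u) [NormedAddCommGroup H] [InnerProductSpace ℂ H]

/-- `ℂ`, `H`, `H ⊗ H`, `H ⊗ (H ⊗ H)`, …, where a tensor product `E ⊗ F` carries the scalar product
with `⟪a ⊗ b, c ⊗ d⟫ = ⟪a, c⟫ * ⟪b, d⟫`. -/
def tensorPowerBundle : ℕ → BundledIPS.{u}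
  | 0 => ⟨ULift.{u} ℂ⟩
  | 1 => ⟨H⟩
  | n + 2 => ⟨H ⊗[ℂ] (tensorPowerBundle (n + 1)).carrier⟩

/-- The algebraic tensor power `H^{⊗ n}` with its standard scalar product. -/
abbrev TensorPow (n : ℕ) : Type u := (tensorPowerBundle H n).carrier

variable {H}

/-- The flip `f ⊗ g ↦ g ⊗ f` on `H ⊗ H`. -/
def flip : TensorPow H 2 →ₗ[ℂ] TensorPow H 2 :=
  (TensorProduct.comm ℂ H H : H ⊗[ℂ] H →ₗ[ℂ] H ⊗[ℂ] H)

/-- The operators `λ_n` on `H^{⊗ n}`: `λ_0 = 1`, `λ_1 = 1`, `λ_2 (f ⊗ g) = f ⊗ g + q (g ⊗ f)`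
and `λ_{n + 1} = 1_H ⊗ λ_n` for `n ≥ 2`, so that `λ_{n + 2} = 1_H^{⊗ n} ⊗ λ_2`. -/
def lam (q : ℝ) : (n : ℕ) → TensorPow H n →ₗ[ℂ] TensorPow H n
  | 0 => LinearMap.id
  | 1 => LinearMap.id
  | 2 => LinearMap.id + (q : ℂ) • flip
  | n + 3 => LinearMap.lTensor H (lam q (n + 2))

/-! ### Positivity of `λ_n` -/

theorem symm_lTensor {E F : Type*} [NormedAddCommGroup E] [InnerProductSpace ℂ E]
    [NormedAddCommGroup F] [InnerProductSpace ℂ F] {B : F →ₗ[ℂ] F}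
    (hB : ∀ x y, inner ℂ (B x) y = inner ℂ x (B y)) (x y : E ⊗[ℂ] F) :
    inner ℂ (B.lTensor E x) y = inner ℂ x (B.lTensor E y) := by
  induction x with
  | zero => simp
  | add a b ha hb => simp only [map_add, inner_add_left, ha, hb]
  | tmul a b =>
    induction y with
    | zero => simp
    | add a b ha hb => simp only [map_add, inner_add_right, ha, hb]
    | tmul c d => simp [hB]

theorem symm_comm {E : Type*} [NormedAddCommGroup E] [InnerProductSpace ℂ E] (x y : E ⊗[ℂ] E) :
    inner ℂ (TensorProduct.comm ℂ E E x) y = inner ℂ x (TensorProduct.comm ℂ E E y) := by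
  induction x with
  | zero => simp
  | add a b ha hb => simp only [map_add, inner_add_left, ha, hb]
  | tmul a b =>
    induction y with
    | zero => simp
    | add a b ha hb => simp only [map_add, inner_add_right, ha, hb]
    | tmul c d => simp [mul_comm]

theorem flip_symm (x y : TensorPow H 2) :
    inner ℂ (flip x) y = inner ℂ x (flip y) :=
  symm_comm (E := H) x y

theorem flip_flip (x : TensorPow H 2) : flip (flip x) = x :=
  (TensorProduct.comm ℂ H H).symm_apply_apply x

/-- Each `λ_n` is the square of a symmetric operator. -/
theorem lam_eq_sq {q : ℝ} (hq : q ∈ Set.Icc (-1 : ℝ) 1) (n : ℕ) :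
    ∃ B : TensorPow H n →ₗ[ℂ] TensorPow H n,
      (∀ x y, inner ℂ (B x) y = inner ℂ x (B y)) ∧ ∀ x, lam q n x = B (B x) := by
  match n with
  | 0 => exact ⟨LinearMap.id, fun _ _ => rfl, fun _ => rfl⟩
  | 1 => exact ⟨LinearMap.id, fun _ _ => rfl, fun _ => rfl⟩
  | 2 =>
    obtain ⟨α, β, h1, h2⟩ : ∃ α β : ℝ, α * α + β * β = 1 ∧ 2 * α * β = q := by
      refine ⟨(√(1 + q) + √(1 - q)) / 2, (√(1 + q) - √(1 - q)) / 2, ?_, ?_⟩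
      all_goals
        have e1 := Real.mul_self_sqrt (show (0 : ℝ) ≤ 1 + q by linarith [hq.1])
        have e2 := Real.mul_self_sqrt (show (0 : ℝ) ≤ 1 - q by linarith [hq.2])
        linarith
    refine ⟨(α : ℂ) • LinearMap.id + (β : ℂ) • flip, fun x y => ?_, fun x => ?_⟩
    · simp only [LinearMap.add_apply, LinearMap.smul_apply, LinearMap.id_apply, inner_add_left,
        inner_add_right, inner_smul_left, inner_smul_right, flip_symm, Complex.conj_ofReal]
    · have h1' : (α : ℂ) * α + β * β = 1 := by exact_mod_cast h1
      have h2' : 2 * (α : ℂ) * β = q := by exact_mod_cast h2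
      simp only [lam, LinearMap.add_apply, LinearMap.smul_apply, LinearMap.id_apply, map_add,
        map_smul, flip_flip]
      rw [← h2']
      calc x + (2 * (α : ℂ) * β) • flip x
          = ((α : ℂ) * α + β * β) • x + (2 * (α : ℂ) * β) • flip x := by rw [h1', one_smul]
        _ = _ := by module
  | n + 3 =>
    obtain ⟨B, hB, hB'⟩ := lam_eq_sq hq (n + 2)
    refine ⟨LinearMap.lTensor H B, fun x y => symm_lTensor hB x y, fun x => ?_⟩
    have : lam q (n + 2) = B ∘ₗ B := LinearMap.ext hB'
    change LinearMap.lTensor H (lam q (n + 2)) x = _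
    rw [this, LinearMap.lTensor_comp]
    rfl

theorem lam_symm {q : ℝ} (hq : q ∈ Set.Icc (-1 : ℝ) 1) (n : ℕ) (x y : TensorPow H n) :
    inner ℂ (lam q n x) y = inner ℂ x (lam q n y) := by
  obtain ⟨B, hB, hB'⟩ := lam_eq_sq (H := H) hq n
  rw [hB', hB', hB, hB]

theorem lam_nonneg {q : ℝ} (hq : q ∈ Set.Icc (-1 : ℝ) 1) (n : ℕ) (x : TensorPow H n) :
    0 ≤ RCLike.re (inner ℂ x (lam q n x)) := by
  obtain ⟨B, hB, hB'⟩ := lam_eq_sq (H := H) hq n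
  rw [hB', ← hB]
  exact inner_self_nonneg

/-! ### The `n`-particle spaces -/

variable (H)

/-- The space `H^{⊗ n}`, to be equipped with the scalar product `⟪F, λ_n G⟫`. -/
def PreParticle (_q : Set.Icc (-1 : ℝ) 1) (n : ℕ) : Type u := TensorPow H n

variable {H}
variable (q : Set.Icc (-1 : ℝ) 1)

instance (n : ℕ) : AddCommGroup (PreParticle H q n) :=
  inferInstanceAs (AddCommGroup (TensorPow H n))

instance (n : ℕ) : Module ℂ (PreParticle H q n) :=
  inferInstanceAs (Module ℂ (TensorPow H n))

/-- The identity map from `H^{⊗ n}` to the same space with the scalar product `⟪F, λ_n G⟫`. -/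
def toPre (n : ℕ) : TensorPow H n ≃ₗ[ℂ] PreParticle H q n :=
  LinearEquiv.refl ℂ (TensorPow H n)

/-- The (possibly degenerate) scalar product `⟪F, G⟫_n = ⟪F, λ_n G⟫` on `H^{⊗ n}`. -/
@[reducible]
def particleCore (n : ℕ) : PreInnerProductSpace.Core ℂ (PreParticle H q n) where
  inner F G := inner ℂ ((toPre q n).symm F) (lam q n ((toPre q n).symm G))
  conj_inner_symm F G := by rw [inner_conj_symm, lam_symm q.2]
  re_inner_nonneg F := lam_nonneg q.2 n _
  add_left F G K := by rw [map_add, inner_add_left]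
  smul_left F G r := by rw [map_smul, inner_smul_left]

instance (n : ℕ) : SeminormedAddCommGroup (PreParticle H q n) :=
  @InnerProductSpace.Core.toSeminormedAddCommGroup ℂ (PreParticle H q n) _ _ _ (particleCore q n)

instance (n : ℕ) : InnerProductSpace ℂ (PreParticle H q n) :=
  InnerProductSpace.ofCore (particleCore q n)

theorem inner_toPre (n : ℕ) (F G : TensorPow H n) :
    inner ℂ (toPre q n F) (toPre q n G) = inner ℂ F (lam q n G) := rfl

variable (H)

/-- The `n`-particle space: the completion of `H^{⊗ n}` modulo the kernel of `⟪·, λ_n ·⟫`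
(`UniformSpace.Completion` identifies vectors at distance zero). -/
abbrev Particle (n : ℕ) : Type u := UniformSpace.Completion (PreParticle H q n)

/-- The class of a tensor in the `n`-particle space. -/
def toParticle (n : ℕ) (F : TensorPow H n) : Particle H q n := (toPre q n F : PreParticle H q n)

/-- The `(q,2)`-Fock space over `H`: the Hilbert space direct sum of the `n`-particle spaces. -/
abbrev Fock : Type u := lp (fun n : ℕ => Particle H q n) 2

/-- The unit `1 ∈ ℂ = H^{⊗ 0}`. -/
def unitTensor : TensorPow H 0 := (ULift.up 1 : ULift.{u} ℂ)

/-- The vacuum vector `1 ⊕ 0 ⊕ 0 ⊕ ⋯`. -/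
def vacuum : Fock H q := lp.single 2 0 (toParticle H q 0 (unitTensor H))

variable {H}

/-! ### Creation, annihilation and field operators -/

/-- Tensoring by `f` from the left, as a map `H^{⊗ n} → H^{⊗ (n + 1)}`: it is `z ↦ z f` for `n = 0`
and `F ↦ f ⊗ F` for `n ≥ 1`. -/
def tensorLeft (f : H) : (n : ℕ) → TensorPow H n →ₗ[ℂ] TensorPow H (n + 1)
  | 0 => (LinearMap.toSpanSingleton ℂ H f) ∘ₗ
      (ULift.moduleEquiv : ULift.{u} ℂ ≃ₗ[ℂ] ℂ).toLinearMap
  | n + 1 => TensorProduct.mk ℂ H (TensorPow H (n + 1)) f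

theorem re_inner_tmul_left {E F : Type*} [NormedAddCommGroup E] [InnerProductSpace ℂ E]
    [NormedAddCommGroup F] [InnerProductSpace ℂ F] (f : E) (x y : F) :
    RCLike.re (inner ℂ (f ⊗ₜ[ℂ] x) (f ⊗ₜ[ℂ] y)) = ‖f‖ ^ 2 * RCLike.re (inner ℂ x y) := by
  rw [TensorProduct.inner_tmul, inner_self_eq_norm_sq_to_K, ← RCLike.ofReal_pow,
    RCLike.re_ofReal_mul]

theorem re_inner_tmul_add_le {E : Type*} [NormedAddCommGroup E] [InnerProductSpace ℂ E]
    {q : ℝ} (hq : q ∈ Set.Icc (-1 : ℝ) 1) (f g : E) :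
    RCLike.re (inner ℂ (f ⊗ₜ[ℂ] g) (f ⊗ₜ[ℂ] g + (q : ℂ) • g ⊗ₜ[ℂ] f)) ≤
      (2 * ‖f‖ ^ 2) * RCLike.re (inner ℂ g g) := by
  have h1 : RCLike.re (inner ℂ (f ⊗ₜ[ℂ] g) ((q : ℂ) • g ⊗ₜ[ℂ] f)) ≤ ‖f‖ ^ 2 * ‖g‖ ^ 2 := by
    refine (re_inner_le_norm (𝕜 := ℂ) (f ⊗ₜ[ℂ] g) ((q : ℂ) • g ⊗ₜ[ℂ] f)).trans ?_
    rw [norm_smul, TensorProduct.norm_tmul, TensorProduct.norm_tmul, Complex.norm_real,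
      Real.norm_eq_abs]
    have h2 : |q| ≤ 1 := abs_le.2 ⟨hq.1, hq.2⟩
    nlinarith [mul_le_mul_of_nonneg_right h2 (sq_nonneg (‖f‖ * ‖g‖))]
  rw [inner_add_right, map_add, re_inner_tmul_left, inner_self_eq_norm_sq]
  linarith

theorem inner_tensorLeft_le {q : ℝ} (hq : q ∈ Set.Icc (-1 : ℝ) 1) (f : H) (n : ℕ)
    (F : TensorPow H n) :
    RCLike.re (inner ℂ (tensorLeft f n F) (lam q (n + 1) (tensorLeft f n F))) ≤
      (2 * ‖f‖ ^ 2) * RCLike.re (inner ℂ F (lam q n F)) := by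
  match n with
  | 0 =>
    change RCLike.re (inner ℂ (F.down • f) (F.down • f)) ≤
      (2 * ‖f‖ ^ 2) * RCLike.re (inner ℂ F.down F.down)
    rw [inner_self_eq_norm_sq, inner_self_eq_norm_sq, norm_smul]
    nlinarith [sq_nonneg (‖f‖ * ‖F.down‖)]
  | 1 => exact re_inner_tmul_add_le (E := H) hq f F
  | n + 2 =>
    have h0 := lam_nonneg hq (n + 2) F
    refine (re_inner_tmul_left (E := H) (F := TensorPow H (n + 2)) f F (lam q (n + 2) F)).trans_le ?_
    nlinarith [mul_nonneg (sq_nonneg ‖f‖) h0]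

/-- The map `tensorLeft` between the spaces with the deformed scalar products. -/
def preCreate (f : H) (n : ℕ) : PreParticle H q n →L[ℂ] PreParticle H q (n + 1) :=
  LinearMap.mkContinuous
    ((toPre q (n + 1)).toLinearMap ∘ₗ tensorLeft f n ∘ₗ (toPre q n).symm.toLinearMap)
    (2 * ‖f‖) fun F => by
      refine le_of_sq_le_sq ?_ (by positivity)
      have h := inner_tensorLeft_le q.2 f n ((toPre q n).symm F)
      have h1 := norm_sq_eq_re_inner (𝕜 := ℂ) F
      have h2 := norm_sq_eq_re_inner (𝕜 := ℂ) (toPre q (n + 1) (tensorLeft f n ((toPre q n).symm F)))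
      have h3 : inner ℂ F F =
        inner ℂ ((toPre q n).symm F) (lam q n ((toPre q n).symm F)) := rfl
      rw [inner_toPre] at h2
      rw [h3] at h1
      rw [← h1, ← h2] at h
      refine h.trans ?_
      nlinarith [sq_nonneg (‖f‖ * ‖F‖)]

/-- Creation by `f` from the `n`-particle space to the `(n + 1)`-particle space: the continuous
extension of `F ↦ f ⊗ F`. -/
def particleCreate (f : H) (n : ℕ) : Particle H q n →L[ℂ] Particle H q (n + 1) :=
  (preCreate q f n).completion

theorem particleCreate_toParticle (f : H) (n : ℕ) (F : TensorPow H n) :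
    particleCreate q f n (toParticle H q n F) = toParticle H q (n + 1) (tensorLeft f n F) :=
  UniformSpace.Completion.map_coe (preCreate q f n).uniformContinuous _

theorem norm_particleCreate_le (f : H) (n : ℕ) (F : Particle H q n) :
    ‖particleCreate q f n F‖ ≤ 2 * ‖f‖ * ‖F‖ := by
  induction F using UniformSpace.Completion.induction_on with
  | hp => exact isClosed_le (by fun_prop) (by fun_prop)
  | ih F =>
    have h : particleCreate q f n F = (preCreate q f n F : Particle H q (n + 1)) :=
      UniformSpace.Completion.map_coe (preCreate q f n).uniformContinuous F
    rw [h, UniformSpace.Completion.norm_coe, UniformSpace.Completion.norm_coe]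
    exact ((preCreate q f n).le_opNorm F).trans
      (mul_le_mul_of_nonneg_right (LinearMap.mkContinuous_norm_le _ (by positivity) _)
        (norm_nonneg F))

/-- The components of the image of a vector of the Fock space under the creation operator. -/
def createSeq (f : H) (F : (n : ℕ) → Particle H q n) : (n : ℕ) → Particle H q n
  | 0 => 0
  | n + 1 => particleCreate q f n (F n)

theorem createSeq_summable (f : H) (F : Fock H q) :
    Summable (fun n => ‖createSeq q f F n‖ ^ 2) ∧
      ∑' n, ‖createSeq q f F n‖ ^ 2 ≤ (2 * ‖f‖ * ‖F‖) ^ 2 := by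
  have hF : HasSum (fun n => ‖F n‖ ^ 2) (‖F‖ ^ 2) := by
    simpa using lp.hasSum_norm (p := 2) (by simp) F
  have hle : ∀ n, ‖createSeq q f F (n + 1)‖ ^ 2 ≤ (2 * ‖f‖) ^ 2 * ‖F n‖ ^ 2 := fun n => by
    rw [← mul_pow]
    exact pow_le_pow_left₀ (norm_nonneg _) (norm_particleCreate_le q f n (F n)) 2
  have hs : Summable (fun n => ‖createSeq q f F (n + 1)‖ ^ 2) :=
    Summable.of_nonneg_of_le (fun n => sq_nonneg _) hle (hF.summable.mul_left _)
  have hs' : Summable (fun n => ‖createSeq q f F n‖ ^ 2) :=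
    (summable_nat_add_iff (f := fun n => ‖createSeq q f F n‖ ^ 2) 1).1 hs
  refine ⟨hs', ?_⟩
  have h0 : ‖createSeq q f F 0‖ ^ 2 = 0 := by simp [createSeq]
  rw [hs'.tsum_eq_zero_add, h0, zero_add, mul_pow (2 * ‖f‖) ‖F‖ 2, ← hF.tsum_eq, ← tsum_mul_left]
  exact hs.tsum_le_tsum hle (hF.summable.mul_left _)

/-- The creation operator `A⁺(f)`. -/
def creation (f : H) : Fock H q →L[ℂ] Fock H q :=
  LinearMap.mkContinuous
    { toFun := fun F => ⟨createSeq q f F, by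
        refine memℓp_gen ?_
        simpa using (createSeq_summable q f F).1⟩
      map_add' := fun F G => by
        refine lp.ext (funext fun n => ?_)
        cases n with
        | zero => exact (add_zero (0 : Particle H q 0)).symm
        | succ n => exact map_add (particleCreate q f n) (F n) (G n)
      map_smul' := fun c F => by
        refine lp.ext (funext fun n => ?_)
        cases n with
        | zero => exact (smul_zero (A := Particle H q 0) c).symm
        | succ n => exact map_smul (particleCreate q f n) c (F n) }
    (2 * ‖f‖) fun F => by
      refine lp.norm_le_of_tsum_le (by simp) (by positivity) ?_
      simpa using (createSeq_summable q f F).2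

/-- The annihilation operator `A(f) = A⁺(f)*`. -/
def annihilation (f : H) : Fock H q →L[ℂ] Fock H q :=
  ContinuousLinearMap.adjoint (creation q f)

/-- The field operator `Q(f) = A(f) + A⁺(f)`. -/
def field (f : H) : Fock H q →L[ℂ] Fock H q := annihilation q f + creation q f

/-! ### Distribution of a bounded self-adjoint operator in a vector state -/

section Distribution

variable {E : Type*} [NormedAddCommGroup E] [InnerProductSpace ℂ E] [CompleteSpace E]

/-- The positive functional `φ ↦ ⟪ψ, φ(T) ψ⟫` on real continuous functions with compact support,
where `φ(T)` is given by the continuous functional calculus. -/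
def vectorFunctional (T : E →L[ℂ] E) (ψ : E) :
    CompactlySupportedContinuousMap ℝ ℝ →ₚ[ℝ] ℝ :=
  PositiveLinearMap.mk₀
    { toFun := fun φ => RCLike.re (inner ℂ ψ (cfc (fun x => φ x) T ψ))
      map_add' := fun φ χ => by
        have h : cfc (fun x => (φ + χ) x) T = cfc (fun x => φ x) T + cfc (fun x => χ x) T :=
          cfc_add T (fun x => φ x) (fun x => χ x) φ.continuous.continuousOn χ.continuous.continuousOn
        rw [h, add_apply, inner_add_right, map_add]
      map_smul' := fun c φ => by
        have h : cfc (fun x => (c • φ) x) T = c • cfc (fun x => φ x) T :=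
          cfc_smul c (fun x => φ x) T φ.continuous.continuousOn
        rw [h, smul_apply, inner_smul_right_eq_smul]
        simp }
    fun φ hφ => by
      have h : 0 ≤ cfc (fun x => φ x) T := cfc_nonneg fun x _ => hφ x
      exact ((ContinuousLinearMap.nonneg_iff_isPositive _).1 h).re_inner_nonneg_right ψ

/-- The distribution of a bounded self-adjoint operator `T` in the state `⟪ψ, · ψ⟫` given by a unit
vector `ψ`: the regular Borel measure `μ` on `ℝ` with `∫ φ dμ = ⟪ψ, φ(T) ψ⟫` for all continuous
functions `φ` with compact support. -/
def distribution (T : E →L[ℂ] E) (ψ : E) : MeasureTheory.Measure ℝ :=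
  RealRMK.rieszMeasure (vectorFunctional T ψ)

end Distribution

/-! ### The density -/

/-- `h_a(x) = x² - (a + 2) x / 4 - 1 / (16 (a - 1))`. -/
def hFun (a x : ℝ) : ℝ := x ^ 2 - (a + 2) / 4 * x - 1 / (16 * (a - 1))

/-- `g_a(x) = √(1 - x) / (√x h_a(x))` for `x ∈ (0, 1)`, and `g_a(x) = 0` otherwise. -/
def gFun (a : ℝ) : ℝ → ℝ :=
  Set.indicator (Set.Ioo 0 1) fun x => √(1 - x) / (√x * hFun a x)

end Q2Fock

end

noncomputable section

namespace Q2Fock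

universe u

variable {H : Type u} [NormedAddCommGroup H] [InnerProductSpace ℂ H] (q : Set.Icc (-1 : ℝ) 1)

/-! ### The cyclic space of the vacuum -/

/-! On the span of the vectors `f^{⊗ n}` the field operator is a Jacobi matrix: creation raises the
degree, and annihilation lowers it with weight `‖f‖²`, except for the extra factor `1 + q` at the
single place where `λ_2` is felt. Hence `Q(f)²` preserves the even vectors, and for `‖f‖ = 1/2` it
acts on them by a three-term recurrence that has constant coefficients from index 2 on
(`sq_field_evenVec_zero`, `sq_field_evenVec_one`, `sq_field_evenVec_add_two`).

A finite perturbation of a constant Jacobi matrix has a Bernstein–Szegő spectral measure. Put `x =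
(1 + cos t) / 2` and `v = e^{it}`, so that `4x = v + v⁻¹ + 2`, and let `b = 1 - a = -q`. The
constant part of the recurrence is solved by `v^m`; fitting the first two rows gives `szegoFun`,
with denominator `1 + b v + b v²`. The real parts of these functions on the circle satisfy the
recurrence of the even vectors. The functions are holomorphic on the closed disc, so by the mean
value property their averages are their values at 0, namely 1 for `m = 0` and 0 otherwise; these are
also the vacuum expectations of the even vectors.

Induction on `k` then identifies the vacuum expectation of `Q(f)^{2k}` with the average of `x^k`
against the zeroth real part (`inner_vacuum_pow_evenVec`). The substitution `x = (1 + cos t) / 2`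
turns that weight into the stated density (`abs_deriv_mul_density`), and compactly supported laws
are determined by their moments (`distribution_eq_of_moments`). -/

/-- The tensor `f ⊗ (f ⊗ ⋯)` with `n` factors. -/
def tensorPowVec (f : H) : (n : ℕ) → TensorPow H n
  | 0 => unitTensor H
  | n + 1 => tensorLeft f n (tensorPowVec f n)

/-- The class of `f^{⊗ n}` in the Fock space. -/
def powVec (f : H) (n : ℕ) : Fock H q := lp.single 2 n (toParticle H q n (tensorPowVec f n))

/-- The coefficients in `A(f) f^{⊗ (n + 1)} = ω_n f^{⊗ n}`, where `c = ‖f‖²`. -/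
def jacobiCoeff (q c : ℝ) : ℕ → ℝ
  | 0 => c
  | 1 => (1 + q) * c
  | _ + 2 => c

theorem creation_apply (f : H) (F : Fock H q) (n : ℕ) :
    creation q f F n = createSeq q f F n := rfl

theorem creation_powVec (f : H) (n : ℕ) : creation q f (powVec q f n) = powVec q f (n + 1) := by
  refine lp.ext (funext fun j => ?_)
  rw [creation_apply]
  cases j with
  | zero =>
    change (0 : Particle H q 0) = _
    simp [powVec, lp.single_apply]
  | succ j =>
    change particleCreate q f j (powVec q f n j) = _
    by_cases h : j = n
    · subst h
      simp [powVec, lp.single_apply, particleCreate_toParticle, tensorPowVec]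
    · simp [powVec, lp.single_apply, h]

theorem inner_tmul_left {E F : Type*} [NormedAddCommGroup E] [InnerProductSpace ℂ E]
    [NormedAddCommGroup F] [InnerProductSpace ℂ F] (f : E) (x y : F) :
    inner ℂ (f ⊗ₜ[ℂ] x) (f ⊗ₜ[ℂ] y) = ((‖f‖ ^ 2 : ℝ) : ℂ) * inner ℂ x y := by
  rw [TensorProduct.inner_tmul, inner_self_eq_norm_sq_to_K]
  norm_cast

theorem inner_tmul_self_add_smul {E : Type*} [NormedAddCommGroup E] [InnerProductSpace ℂ E]
    (q : ℝ) (f g : E) :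
    inner ℂ (f ⊗ₜ[ℂ] f) (f ⊗ₜ[ℂ] g + (q : ℂ) • g ⊗ₜ[ℂ] f) =
      (((1 + q) * ‖f‖ ^ 2 : ℝ) : ℂ) * inner ℂ f g := by
  have hff : inner ℂ f f = ((‖f‖ ^ 2 : ℝ) : ℂ) := by
    rw [inner_self_eq_norm_sq_to_K]; norm_cast
  rw [TensorProduct.smul_tmul']
  simp only [inner_add_right, inner_smul_right, TensorProduct.inner_tmul, hff]
  push_cast
  ring

/-- For `n ≥ 2` the operator `λ_{n+1}` acts as the identity on the first factor, which contributes
only `⟪f, f⟫`. The deformation touches the first factor only for `n = 1`, where the flipped term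
adds `q ‖f‖²`. -/
theorem inner_tensorPowVec_tensorLeft (f : H) (n : ℕ) (F : TensorPow H n) :
    inner ℂ (tensorPowVec f (n + 1)) (lam q (n + 1) (tensorLeft f n F)) =
      (jacobiCoeff q (‖f‖ ^ 2) n : ℂ) * inner ℂ (tensorPowVec f n) (lam q n F) := by
  have hff : inner ℂ f f = ((‖f‖ ^ 2 : ℝ) : ℂ) := by
    rw [inner_self_eq_norm_sq_to_K]; norm_cast
  match n with
  | 0 =>
    change inner ℂ ((1 : ℂ) • f) (F.down • f) = ((‖f‖ ^ 2 : ℝ) : ℂ) * inner ℂ (1 : ℂ) F.down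
    simp only [one_smul, inner_smul_right, hff, RCLike.inner_apply, map_one, mul_one]
    ring
  | 1 =>
    have h1 : tensorPowVec f 1 = f := one_smul ℂ f
    rw [show tensorPowVec f 2 = tensorLeft f 1 (tensorPowVec f 1) from rfl, h1]
    exact inner_tmul_self_add_smul (E := H) q f F
  | n + 2 =>
    exact inner_tmul_left (E := H) (F := TensorPow H (n + 2)) f (tensorPowVec f (n + 2))
      (lam q (n + 2) F)

theorem inner_toParticle (n : ℕ) (F G : TensorPow H n) :
    inner ℂ (toParticle H q n F) (toParticle H q n G) = inner ℂ F (lam q n G) :=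
  (UniformSpace.Completion.inner_coe _ _).trans (inner_toPre q n F G)

theorem inner_particleCreate (f : H) (n : ℕ) (F : Particle H q n) :
    inner ℂ (toParticle H q (n + 1) (tensorPowVec f (n + 1))) (particleCreate q f n F) =
      (jacobiCoeff q (‖f‖ ^ 2) n : ℂ) * inner ℂ (toParticle H q n (tensorPowVec f n)) F := by
  induction F using UniformSpace.Completion.induction_on with
  | hp => exact isClosed_eq (by fun_prop) (by fun_prop)
  | ih F =>
    have h := particleCreate_toParticle q f n ((toPre q n).symm F)
    have h' : toParticle H q n ((toPre q n).symm F) = (F : Particle H q n) := rfl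
    rw [← h', h, inner_toParticle, inner_toParticle, inner_tensorPowVec_tensorLeft]

theorem annihilation_powVec_zero (f : H) : annihilation q f (powVec q f 0) = 0 := by
  refine ext_inner_right ℂ fun G => ?_
  rw [annihilation, ContinuousLinearMap.adjoint_inner_left, powVec, lp.inner_single_left,
    creation_apply, inner_zero_left]
  exact inner_zero_right _

/-- Tested against a vector `G`, the adjoint sees only the component of `A⁺(f) G` in degree `n + 1`,
that is, the creation of `G n`; this reduces the claim to `inner_particleCreate`. -/
theorem annihilation_powVec_succ (f : H) (n : ℕ) :
    annihilation q f (powVec q f (n + 1)) =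
      (jacobiCoeff q (‖f‖ ^ 2) n : ℂ) • powVec q f n := by
  refine ext_inner_right ℂ fun G => ?_
  rw [annihilation, ContinuousLinearMap.adjoint_inner_left, powVec, lp.inner_single_left,
    creation_apply, inner_smul_left, Complex.conj_ofReal, powVec, lp.inner_single_left]
  exact inner_particleCreate q f n (G n)

theorem field_powVec_zero (f : H) : field q f (powVec q f 0) = powVec q f 1 := by
  rw [field, add_apply, annihilation_powVec_zero, creation_powVec, zero_add]

theorem field_powVec_succ (f : H) (n : ℕ) :
    field q f (powVec q f (n + 1)) =
      (jacobiCoeff q (‖f‖ ^ 2) n : ℂ) • powVec q f n + powVec q f (n + 2) := by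
  rw [field, add_apply, annihilation_powVec_succ, creation_powVec]

theorem powVec_zero (f : H) : powVec q f 0 = vacuum H q := rfl

theorem inner_vacuum_powVec_succ (f : H) (n : ℕ) :
    inner ℂ (vacuum H q) (powVec q f (n + 1)) = 0 := by
  rw [vacuum, lp.inner_single_left, powVec, lp.single_apply]
  simp

theorem inner_vacuum_vacuum : inner ℂ (vacuum H q) (vacuum H q) = (1 : ℂ) := by
  rw [vacuum, lp.inner_single_left, lp.single_apply, Pi.single_eq_same, inner_toParticle]
  change inner ℂ (1 : ℂ) (1 : ℂ) = 1
  simp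

theorem norm_vacuum : ‖vacuum H q‖ = 1 := by
  have h := inner_self_eq_norm_sq (𝕜 := ℂ) (vacuum H q)
  rw [inner_vacuum_vacuum, RCLike.one_re] at h
  exact (pow_eq_one_iff_of_nonneg (norm_nonneg _) two_ne_zero).1 h.symm

theorem isSelfAdjoint_field (f : H) : IsSelfAdjoint (field q f) := by
  rw [field, annihilation, ← ContinuousLinearMap.star_eq_adjoint]
  exact IsSelfAdjoint.star_add_self _

/-! ### The square of the field on even vectors -/

/-- The normalised even vectors `4^m f^{⊗ 2m}`, on which `Q(f)²` acts as a Jacobi matrix. -/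
def evenVec (f : H) (m : ℕ) : Fock H q := (4 ^ m : ℂ) • powVec q f (2 * m)

theorem inner_vacuum_evenVec (f : H) (m : ℕ) :
    inner ℂ (vacuum H q) (evenVec q f m) = if m = 0 then 1 else 0 := by
  cases m with
  | zero => simp [evenVec, powVec_zero, norm_vacuum]
  | succ m =>
    rw [evenVec, inner_smul_right, show 2 * (m + 1) = 2 * m + 1 + 1 by ring,
      inner_vacuum_powVec_succ]
    simp

theorem sq_field_evenVec_zero {f : H} (hf : ‖f‖ = 1 / 2) :
    (field q f ^ 2) (evenVec q f 0) = (4⁻¹ : ℂ) • (evenVec q f 1 + evenVec q f 0) := by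
  have hc : ‖f‖ ^ 2 = 1 / 4 := by rw [hf]; norm_num
  simp only [evenVec, pow_two, mul_apply_eq_comp, map_smul, mul_zero,
    field_powVec_zero, field_powVec_succ, jacobiCoeff, hc, mul_one, zero_add]
  push_cast
  module

theorem sq_field_evenVec_one {f : H} (hf : ‖f‖ = 1 / 2) :
    (field q f ^ 2) (evenVec q f 1) = (4⁻¹ : ℂ) •
      (evenVec q f 2 + (2 + (q : ℝ) : ℂ) • evenVec q f 1 + (1 + (q : ℝ) : ℂ) • evenVec q f 0) := by
  have hc : ‖f‖ ^ 2 = 1 / 4 := by rw [hf]; norm_num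
  simp only [evenVec, pow_two, mul_apply_eq_comp, map_smul, map_add, mul_zero, mul_one,
    field_powVec_succ q f 1, field_powVec_succ q f 2, jacobiCoeff, hc]
  rw [field_powVec_succ q f 0]
  simp only [jacobiCoeff, hc]
  norm_num
  module

theorem sq_field_evenVec_add_two {f : H} (hf : ‖f‖ = 1 / 2) (m : ℕ) :
    (field q f ^ 2) (evenVec q f (m + 2)) = (4⁻¹ : ℂ) •
      (evenVec q f (m + 3) + (2 : ℂ) • evenVec q f (m + 2) + evenVec q f (m + 1)) := by
  have hc : ‖f‖ ^ 2 = 1 / 4 := by rw [hf]; norm_num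
  simp only [evenVec, pow_two, mul_apply_eq_comp]
  -- In this form all coefficients met have index `2m + 2`, `2m + 3` or `2m + 4`, hence lie in the
  -- constant range of `jacobiCoeff`.
  rw [show 2 * (m + 2) = 2 * m + 3 + 1 by ring, show 2 * (m + 3) = 2 * m + 3 + 3 by ring,
    show 2 * (m + 1) = 2 * m + 2 by ring]
  rw [map_smul, field_powVec_succ, map_smul, map_add, map_smul, field_powVec_succ q f (2 * m + 2),
    field_powVec_succ q f (2 * m + 3 + 1)]
  simp only [jacobiCoeff, hc, pow_add]
  push_cast
  module

open MeasureTheory Set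

/-! ### Determination of the distribution by moments -/

section Moments

variable {E : Type*} [NormedAddCommGroup E] [InnerProductSpace ℂ E]

theorem integrable_of_ae_mem_Icc {μ : Measure ℝ} [IsFiniteMeasure μ] {R : ℝ}
    (hR : ∀ᵐ x ∂μ, x ∈ Icc (-R) R) {g : ℝ → ℝ} (hg : Continuous g) : Integrable g μ := by
  obtain ⟨C, hC⟩ := isCompact_Icc.exists_bound_of_continuousOn (hg.continuousOn (s := Icc (-R) R))
  exact Integrable.of_bound hg.aestronglyMeasurable C (hR.mono hC)

theorem re_inner_aeval_eq_integral {T : E →L[ℂ] E} {ψ : E} {μ : Measure ℝ} [IsFiniteMeasure μ]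
    {R : ℝ} (hR : ∀ᵐ x ∂μ, x ∈ Icc (-R) R)
    (hm : ∀ k : ℕ, RCLike.re (inner ℂ ψ ((T ^ k) ψ)) = ∫ x, x ^ k ∂μ) (p : Polynomial ℝ) :
    RCLike.re (inner ℂ ψ (Polynomial.aeval T p ψ)) = ∫ x, p.eval x ∂μ := by
  induction p using Polynomial.induction_on' with
  | add p r hp hr =>
    simp only [map_add, add_apply, inner_add_right, Polynomial.eval_add]
    rw [hp, hr, integral_add (integrable_of_ae_mem_Icc hR p.continuous)
      (integrable_of_ae_mem_Icc hR r.continuous)]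
  | monomial k c =>
    have h : Polynomial.aeval T (Polynomial.monomial k c) ψ = (c : ℂ) • (T ^ k) ψ := by
      rw [Polynomial.aeval_monomial, ← Algebra.smul_def]
      rfl
    simp only [h, inner_smul_right, Polynomial.eval_monomial]
    rw [integral_const_mul, ← hm]
    exact RCLike.re_ofReal_mul _ _

/-- A compactly supported probability measure with the moments of `T` in the state `⟪ψ, · ψ⟫` is
the distribution of `T`. -/
theorem distribution_eq_of_moments [CompleteSpace E] {T : E →L[ℂ] E}
    (hT : IsSelfAdjoint T) {ψ : E} (hψ : ‖ψ‖ = 1)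
    {μ : Measure ℝ} [IsProbabilityMeasure μ] {R : ℝ} (hR : ∀ᵐ x ∂μ, x ∈ Icc (-R) R)
    (hm : ∀ k : ℕ, RCLike.re (inner ℂ ψ ((T ^ k) ψ)) = ∫ x, x ^ k ∂μ) :
    distribution T ψ = μ := by
  have : Nontrivial E := ⟨ψ, 0, fun h => by simp [h] at hψ⟩
  have : (distribution T ψ).Regular := by unfold distribution; infer_instance
  refine Measure.ext_of_integral_eq_on_compactlySupported fun φ => ?_
  rw [distribution, RealRMK.integral_rieszMeasure]
  change RCLike.re (inner ℂ ψ (cfc (fun x => φ x) T ψ)) = _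
  refine eq_of_forall_dist_le fun ε hε => ?_
  -- The polynomial approximation must be uniform both on the support of `μ` and on the spectrum of
  -- `T`; this interval contains both.
  set S := max R ‖T‖
  have hS : ∀ᵐ x ∂μ, x ∈ Icc (-S) S := hR.mono fun x hx =>
    ⟨by linarith [hx.1, le_max_left R ‖T‖], hx.2.trans (le_max_left _ _)⟩
  obtain ⟨p, hp⟩ := exists_polynomial_near_of_continuousOn (-S) S φ φ.continuous.continuousOn
    (ε / 2) (half_pos hε)
  rw [Real.dist_eq]
  have h1 : |RCLike.re (inner ℂ ψ (cfc (fun x => φ x) T ψ)) -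
      RCLike.re (inner ℂ ψ (Polynomial.aeval T p ψ))| ≤ ε / 2 := by
    rw [← cfc_polynomial p T hT, ← map_sub, ← inner_sub_right, ← sub_apply,
      ← cfc_sub (fun x => φ x) p.eval T φ.continuous.continuousOn p.continuous.continuousOn]
    have h2 : ‖cfc (fun x => φ x - p.eval x) T‖ ≤ ε / 2 := by
      refine norm_cfc_le (half_pos hε).le fun x hx => ?_
      have hx' : |x| ≤ ‖T‖ := spectrum.norm_le_norm_of_mem hx
      rw [Real.norm_eq_abs, abs_sub_comm]
      exact (hp x (abs_le.1 (hx'.trans (le_max_right _ _)))).le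
    refine (RCLike.abs_re_le_norm _).trans ((norm_inner_le_norm _ _).trans ?_)
    rw [hψ, one_mul]
    refine (ContinuousLinearMap.le_opNorm _ _).trans ?_
    rw [hψ, mul_one]
    exact h2
  have h3 : |∫ x, p.eval x ∂μ - ∫ x, φ x ∂μ| ≤ ε / 2 := by
    rw [← integral_sub (integrable_of_ae_mem_Icc hS p.continuous)
      (integrable_of_ae_mem_Icc (g := φ) hS φ.continuous)]
    have := norm_integral_le_of_norm_le_const (μ := μ) (f := fun x => p.eval x - φ x)
      (hS.mono fun x hx => (hp x hx).le)
    simpa using this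
  rw [re_inner_aeval_eq_integral hR hm] at h1
  calc _ ≤ _ := abs_sub_le _ (∫ x, p.eval x ∂μ) _
    _ ≤ ε := by linarith

end Moments

/-! ### The limiting measure in the angular variable -/

section Angular

/-- The polynomial `1 + b v + b v²` in the denominator of the Bernstein–Szegő weight. -/
def szego (b : ℝ) (v : ℂ) : ℂ := 1 + b * v + b * v ^ 2

/-- The quadratic has no real root since `b < 4`, and its conjugate roots have product `1 / b > 1`,
so both lie outside the closed disc. -/
theorem szego_ne_zero {b : ℝ} (hb : b ∈ Ioo (0 : ℝ) 1) {v : ℂ} (hv : ‖v‖ ≤ 1) :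
    szego b v ≠ 0 := by
  intro h
  have hn : v.re * v.re + v.im * v.im ≤ 1 := by
    rw [← Complex.normSq_apply, Complex.normSq_eq_norm_sq]
    nlinarith [norm_nonneg v]
  have hre := congrArg Complex.re h
  have him := congrArg Complex.im h
  simp [szego, pow_two] at hre him
  have h1 : b * (v.im * (1 + 2 * v.re)) = 0 := by linarith
  rcases mul_eq_zero.1 ((mul_eq_zero.1 h1).resolve_left hb.1.ne') with h0 | h0
  · rw [h0] at hre
    nlinarith [hb.1, hb.2, mul_nonneg hb.1.le (sq_nonneg (2 * v.re + 1))]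
  · have h2 : v.re = -1 / 2 := by linarith
    rw [h2] at hre hn
    nlinarith [hb.1, hb.2]

/-- Holomorphic functions whose real parts on the unit circle are the orthogonal polynomials times
the weight. -/
def szegoFun (b : ℝ) : ℕ → ℂ → ℂ
  | 0 => fun v => (1 - v) * (1 + b * v) / szego b v
  | m + 1 => fun v => (1 - b) * (1 - v) * v ^ (m + 1) / szego b v

theorem szegoFun_differentiableAt {b : ℝ} (hb : b ∈ Ioo (0 : ℝ) 1) (m : ℕ) {v : ℂ}
    (hv : ‖v‖ ≤ 1) : DifferentiableAt ℂ (szegoFun b m) v := by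
  have h := szego_ne_zero hb hv
  have hd : DifferentiableAt ℂ (szego b) v := by unfold szego; fun_prop
  cases m <;> simp only [szegoFun] <;> exact DifferentiableAt.div (by fun_prop) hd h

/-- The real part of `szegoFun` at `e^{it}`. -/
def szegoRe (b : ℝ) (m : ℕ) (t : ℝ) : ℝ := (szegoFun b m (circleMap 0 1 t)).re

theorem norm_circleMap_zero_one (t : ℝ) : ‖circleMap 0 1 t‖ = 1 := by simp

theorem continuous_szegoFun_circleMap {b : ℝ} (hb : b ∈ Ioo (0 : ℝ) 1) (m : ℕ) :
    Continuous fun t => szegoFun b m (circleMap 0 1 t) :=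
  continuous_iff_continuousAt.2 fun t =>
    ContinuousAt.comp (f := circleMap 0 1)
      (szegoFun_differentiableAt hb m (norm_circleMap_zero_one t).le).continuousAt
      (continuous_circleMap 0 1).continuousAt

theorem continuous_szegoRe {b : ℝ} (hb : b ∈ Ioo (0 : ℝ) 1) (m : ℕ) : Continuous (szegoRe b m) :=
  Complex.continuous_re.comp (continuous_szegoFun_circleMap hb m)

theorem szegoFun_conj (b : ℝ) (m : ℕ) (v : ℂ) :
    szegoFun b m (starRingEnd ℂ v) = starRingEnd ℂ (szegoFun b m v) := by
  cases m <;> simp [szegoFun, szego]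

theorem szegoRe_two_pi_sub (b : ℝ) (m : ℕ) (t : ℝ) :
    szegoRe b m (2 * Real.pi - t) = szegoRe b m t := by
  have h : circleMap 0 1 (2 * Real.pi - t) = starRingEnd ℂ (circleMap 0 1 t) := by
    simp only [circleMap, Complex.ofReal_one, one_mul, zero_add, ← Complex.exp_conj]
    push_cast
    rw [sub_mul, sub_eq_neg_add, Complex.exp_add, Complex.exp_two_pi_mul_I]
    simp
  rw [szegoRe, h, szegoFun_conj, Complex.conj_re, szegoRe]

/-- This is the mean value property at 0. Real coefficients make the integrand symmetric under `t ↦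
2π - t`, so the half circle carries half of the integral. -/
theorem integral_szegoRe {b : ℝ} (hb : b ∈ Ioo (0 : ℝ) 1) (m : ℕ) :
    ∫ t in (0 : ℝ)..Real.pi, szegoRe b m t = if m = 0 then Real.pi else 0 := by
  have hd : DiffContOnCl ℂ (szegoFun b m) (Metric.ball 0 |1|) := by
    refine DifferentiableOn.diffContOnCl fun v hv => ?_
    rw [abs_one, closure_ball _ one_ne_zero, mem_closedBall_zero_iff] at hv
    exact (szegoFun_differentiableAt hb m hv).differentiableWithinAt
  have h1 := hd.circleAverage
  have h2 : CircleIntegrable (szegoFun b m) 0 1 :=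
    (continuous_szegoFun_circleMap hb m).intervalIntegrable _ _
  have h3 := Complex.reCLM.circleAverage_comp_comm h2
  rw [h1, Real.circleAverage_def] at h3
  have h4 : ∫ t in (0 : ℝ)..2 * Real.pi, szegoRe b m t =
      2 * ∫ t in (0 : ℝ)..Real.pi, szegoRe b m t := by
    have hi := fun x y => (continuous_szegoRe hb m).intervalIntegrable (μ := volume) x y
    rw [← intervalIntegral.integral_add_adjacent_intervals (hi 0 Real.pi) (hi Real.pi _)]
    have := intervalIntegral.integral_comp_sub_left (a := 0) (b := Real.pi)
      (szegoRe b m) (2 * Real.pi)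
    simp only [szegoRe_two_pi_sub] at this
    rw [show 2 * Real.pi - Real.pi = Real.pi by ring, sub_zero] at this
    rw [← this]
    ring
  change (2 * Real.pi)⁻¹ • ∫ t in (0 : ℝ)..2 * Real.pi, szegoRe b m t = (szegoFun b m 0).re at h3
  rw [h4, smul_eq_mul] at h3
  have h5 : (szegoFun b m 0).re = if m = 0 then 1 else 0 := by
    cases m <;> simp [szegoFun, szego]
  rw [h5] at h3
  have := Real.pi_pos
  field_simp at h3
  rw [h3]
  simp

/-! ### The three-term recurrence on the unit circle -/

/-- The variable `x = (1 + cos t) / 2` in terms of the angle `t`. -/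
def halfCos (t : ℝ) : ℝ := (1 + Real.cos t) / 2

theorem inv_circleMap_zero_one (t : ℝ) :
    (circleMap 0 1 t)⁻¹ = starRingEnd ℂ (circleMap 0 1 t) := by
  rw [Complex.inv_def, Complex.normSq_eq_norm_sq, norm_circleMap_zero_one]
  simp

theorem four_mul_halfCos (t : ℝ) :
    ((4 * halfCos t : ℝ) : ℂ) = circleMap 0 1 t + (circleMap 0 1 t)⁻¹ + 2 := by
  have h : (circleMap 0 1 t).re = Real.cos t := by simp [circleMap, Complex.exp_ofReal_mul_I_re]
  rw [inv_circleMap_zero_one, Complex.add_conj, h, halfCos]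
  push_cast
  ring

theorem four_mul_halfCos_mul_szegoRe (b : ℝ) (m : ℕ) (t : ℝ) :
    4 * (halfCos t * szegoRe b m t) =
      ((circleMap 0 1 t + (circleMap 0 1 t)⁻¹ + 2) * szegoFun b m (circleMap 0 1 t)).re := by
  rw [← four_mul_halfCos, Complex.re_ofReal_mul, szegoRe, mul_assoc]

theorem halfCos_mul_szegoRe_zero {b : ℝ} (hb : b ∈ Ioo (0 : ℝ) 1) (t : ℝ) :
    4 * (halfCos t * szegoRe b 0 t) = szegoRe b 1 t + szegoRe b 0 t := by
  have h0 : circleMap 0 1 t ≠ 0 := circleMap_ne_center one_ne_zero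
  have hs := szego_ne_zero hb (norm_circleMap_zero_one t).le
  have hi := congrArg Complex.re (inv_circleMap_zero_one t)
  rw [four_mul_halfCos_mul_szegoRe]
  -- The recurrence fails for the holomorphic functions by `v⁻¹ - v`, because the denominator
  -- cancels in the defect; on the circle this is purely imaginary and disappears from the real
  -- part. The later rows hold exactly.
  have key : (circleMap 0 1 t + (circleMap 0 1 t)⁻¹ + 2) * szegoFun b 0 (circleMap 0 1 t) =
      szegoFun b 1 (circleMap 0 1 t) + szegoFun b 0 (circleMap 0 1 t) +
        ((circleMap 0 1 t)⁻¹ - circleMap 0 1 t) := by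
    generalize circleMap 0 1 t = v at *
    simp only [szegoFun]
    field_simp
    simp only [szego]
    ring
  rw [key, Complex.add_re, Complex.add_re, Complex.sub_re, hi, Complex.conj_re, sub_self, add_zero]
  rfl

theorem halfCos_mul_szegoRe_one {b : ℝ} (hb : b ∈ Ioo (0 : ℝ) 1) (t : ℝ) :
    4 * (halfCos t * szegoRe b 1 t) =
      szegoRe b 2 t + (2 - b) * szegoRe b 1 t + (1 - b) * szegoRe b 0 t := by
  have h0 : circleMap 0 1 t ≠ 0 := circleMap_ne_center one_ne_zero
  have hs := szego_ne_zero hb (norm_circleMap_zero_one t).le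
  rw [four_mul_halfCos_mul_szegoRe]
  simp only [szegoRe, ← Complex.re_ofReal_mul, ← Complex.add_re]
  generalize circleMap 0 1 t = v at *
  congr 1
  simp only [szegoFun]
  push_cast
  field_simp
  ring

theorem halfCos_mul_szegoRe_add_two (b : ℝ) (m : ℕ) (t : ℝ) :
    4 * (halfCos t * szegoRe b (m + 2) t) =
      szegoRe b (m + 3) t + 2 * szegoRe b (m + 2) t + szegoRe b (m + 1) t := by
  have h0 : circleMap 0 1 t ≠ 0 := circleMap_ne_center one_ne_zero
  rw [four_mul_halfCos_mul_szegoRe]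
  rw [show (2 : ℝ) * szegoRe b (m + 2) t = ((2 : ℝ) * szegoFun b (m + 2) (circleMap 0 1 t)).re from
    (Complex.re_ofReal_mul _ _).symm]
  simp only [szegoRe, ← Complex.add_re]
  generalize circleMap 0 1 t = v at *
  congr 1
  simp only [szegoFun]
  push_cast
  field_simp
  ring

/-! ### The weight in the variable `x` -/

theorem hFun_pos {a : ℝ} (ha : a ∈ Ioo (0 : ℝ) 1) (x : ℝ) : 0 < hFun a x := by
  have h1 : 0 < 1 - a := by linarith [ha.2]
  have h2 : hFun a x = (x - (a + 2) / 8) ^ 2 + a ^ 2 * (3 + a) / (64 * (1 - a)) := by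
    rw [hFun, show a - 1 = -(1 - a) by ring]
    field_simp
    ring
  rw [h2]
  have := ha.1
  positivity

theorem normSq_szego_circleMap {b : ℝ} (hb : b ∈ Ioo (0 : ℝ) 1) (t : ℝ) :
    Complex.normSq (szego b (circleMap 0 1 t)) = 16 * b * hFun (1 - b) (halfCos t) := by
  have hc : (circleMap 0 1 t).re = Real.cos t := by simp [circleMap, Complex.exp_ofReal_mul_I_re]
  have hs : (circleMap 0 1 t).im = Real.sin t := by simp [circleMap, Complex.exp_ofReal_mul_I_im]
  have h1 := Real.sin_sq_add_cos_sq t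
  have hb0 := hb.1.ne'
  have h2 : 16 * b * hFun (1 - b) (halfCos t) =
      16 * b * (halfCos t ^ 2 - (3 - b) / 4 * halfCos t) + 1 := by
    rw [hFun, show (1 - b - 1) = -b by ring]
    field_simp
    ring
  rw [h2, Complex.normSq_apply]
  simp [szego, pow_two, hc, hs, halfCos]
  generalize Real.cos t = c at *
  generalize Real.sin t = s at *
  have h3 : s ^ 2 = 1 - c ^ 2 := by linarith
  linear_combination (b ^ 2 * (s ^ 2 + 1 + c ^ 2) + 2 * b ^ 2 * c + b ^ 2 - 2 * b) * h3

/-- Multiplying numerator and denominator by the conjugate of `1 + b v + b v²`, the `cos 2t` terms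
in the real part of the numerator cancel. -/
theorem szegoRe_zero_eq {b : ℝ} (hb : b ∈ Ioo (0 : ℝ) 1) (t : ℝ) :
    szegoRe b 0 t = (1 - b) * (1 - Real.cos t) / (16 * b * hFun (1 - b) (halfCos t)) := by
  have hc : (circleMap 0 1 t).re = Real.cos t := by simp [circleMap, Complex.exp_ofReal_mul_I_re]
  have hs : (circleMap 0 1 t).im = Real.sin t := by simp [circleMap, Complex.exp_ofReal_mul_I_im]
  have h1 := Real.sin_sq_add_cos_sq t
  rw [← normSq_szego_circleMap hb, szegoRe, szegoFun, Complex.div_re, ← add_div]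
  congr 1
  simp [szego, pow_two, hc, hs]
  generalize Real.cos t = c at *
  generalize Real.sin t = s at *
  have h3 : s ^ 2 = 1 - c ^ 2 := by linarith
  linear_combination -(b * c + b + b ^ 2 * (s ^ 2 + c ^ 2)) * h3

theorem sin_eq_sqrt_mul_sqrt {t : ℝ} (ht : t ∈ Ioo 0 Real.pi) :
    Real.sin t = 2 * (√(halfCos t) * √(1 - halfCos t)) := by
  have h0 := Real.neg_one_le_cos t
  rw [← Real.sqrt_mul (by unfold halfCos; linarith), Real.sin_eq_sqrt_one_sub_cos_sq ht.1.le ht.2.le,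
    show halfCos t * (1 - halfCos t) = (1 - Real.cos t ^ 2) / 2 ^ 2 by unfold halfCos; ring,
    Real.sqrt_div' _ (by positivity), Real.sqrt_sq (by norm_num)]
  ring

theorem halfCos_mem {t : ℝ} (ht : t ∈ Ioo 0 Real.pi) : halfCos t ∈ Ioo (0 : ℝ) 1 := by
  have h1 := Real.cos_lt_cos_of_nonneg_of_le_pi le_rfl ht.2.le ht.1
  have h2 := Real.cos_lt_cos_of_nonneg_of_le_pi ht.1.le le_rfl ht.2
  rw [Real.cos_zero] at h1
  rw [Real.cos_pi] at h2
  constructor <;> unfold halfCos <;> linarith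

theorem halfCos_image : halfCos '' Ioo 0 Real.pi = Ioo 0 1 := by
  refine Subset.antisymm (image_subset_iff.2 fun t ht => halfCos_mem ht) fun x hx => ?_
  have h1 : Real.cos (Real.arccos (2 * x - 1)) = 2 * x - 1 :=
    Real.cos_arccos (by linarith [hx.1]) (by linarith [hx.2])
  refine ⟨Real.arccos (2 * x - 1), ⟨Real.arccos_pos.2 (by linarith [hx.2]), ?_⟩, ?_⟩
  · refine lt_of_le_of_ne (Real.arccos_le_pi _) fun h => ?_
    rw [h, Real.cos_pi] at h1
    linarith [hx.1]
  · rw [halfCos, h1]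
    ring

theorem halfCos_injOn : InjOn halfCos (Ioo 0 Real.pi) := fun x hx y hy h => by
  refine Real.injOn_cos (Ioo_subset_Icc_self hx) (Ioo_subset_Icc_self hy) ?_
  unfold halfCos at h
  linarith

theorem hasDerivAt_halfCos (t : ℝ) : HasDerivAt halfCos (-Real.sin t / 2) t :=
  ((Real.hasDerivAt_cos t).const_add 1).div_const 2

/-- The Jacobian is `√x √(1 - x)`: it removes the singular `√x` and completes `√(1 - x)` to `1 - x =
(1 - cos t) / 2`, the numerator of the zeroth real part. -/
theorem abs_deriv_mul_density {a : ℝ} (ha : a ∈ Ioo (0 : ℝ) 1) {t : ℝ} (ht : t ∈ Ioo 0 Real.pi) :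
    |-Real.sin t / 2| * (a / (8 * Real.pi * (1 - a)) * gFun a (halfCos t)) =
      Real.pi⁻¹ * szegoRe (1 - a) 0 t := by
  have hy := halfCos_mem ht
  have hb : 1 - a ∈ Ioo (0 : ℝ) 1 := ⟨by linarith [ha.2], by linarith [ha.1]⟩
  have h1 : |-Real.sin t / 2| = √(halfCos t) * √(1 - halfCos t) := by
    rw [abs_div, abs_neg, abs_of_pos (Real.sin_pos_of_mem_Ioo ht), sin_eq_sqrt_mul_sqrt ht]
    norm_num
  have h2 : √(1 - halfCos t) * √(1 - halfCos t) = 1 - halfCos t :=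
    Real.mul_self_sqrt (by linarith [hy.2])
  have h3 : √(halfCos t) ≠ 0 := (Real.sqrt_pos.2 hy.1).ne'
  have h4 := (hFun_pos ha (halfCos t)).ne'
  have h5 := hb.1.ne'
  have h6 := Real.pi_pos.ne'
  have h7 : Real.cos t = 2 * halfCos t - 1 := by unfold halfCos; ring
  rw [szegoRe_zero_eq hb, sub_sub_cancel, h1, gFun, indicator_of_mem hy, h7]
  field_simp
  rw [pow_two, h2]
  ring

/-! ### The probability measure with this density -/

theorem gFun_nonneg {a : ℝ} (ha : a ∈ Ioo (0 : ℝ) 1) (x : ℝ) : 0 ≤ gFun a x :=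
  indicator_nonneg (fun x _ => div_nonneg (Real.sqrt_nonneg _)
    (mul_nonneg (Real.sqrt_nonneg _) (hFun_pos ha x).le)) x

theorem measurable_gFun (a : ℝ) : Measurable (gFun a) := by
  unfold gFun hFun
  exact Measurable.indicator (by fun_prop) measurableSet_Ioo

/-- The density of the distribution of `Q(f)²`. -/
def density (a x : ℝ) : ℝ := a / (8 * Real.pi * (1 - a)) * gFun a x

theorem density_nonneg {a : ℝ} (ha : a ∈ Ioo (0 : ℝ) 1) (x : ℝ) : 0 ≤ density a x :=
  mul_nonneg (div_nonneg ha.1.le (mul_nonneg (by positivity) (by linarith [ha.2])))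
    (gFun_nonneg ha x)

theorem measurable_density (a : ℝ) : Measurable (density a) := (measurable_gFun a).const_mul _

theorem density_eq_zero (a : ℝ) {x : ℝ} (hx : x ∉ Ioo (0 : ℝ) 1) : density a x = 0 := by
  rw [density, gFun, indicator_of_notMem hx, mul_zero]

theorem integral_density_mul {a : ℝ} (ha : a ∈ Ioo (0 : ℝ) 1) (F : ℝ → ℝ) :
    ∫ x, density a x * F x = Real.pi⁻¹ * ∫ t in (0 : ℝ)..Real.pi,
      F (halfCos t) * szegoRe (1 - a) 0 t := by
  rw [← setIntegral_eq_integral_of_forall_compl_eq_zero (s := Ioo (0 : ℝ) 1)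
    fun x hx => by rw [density_eq_zero a hx, zero_mul], ← halfCos_image,
    integral_image_eq_integral_abs_deriv_smul measurableSet_Ioo
      (fun t _ => (hasDerivAt_halfCos t).hasDerivWithinAt) halfCos_injOn,
    intervalIntegral.integral_of_le Real.pi_pos.le, integral_Ioc_eq_integral_Ioo,
    ← integral_const_mul]
  refine setIntegral_congr_fun measurableSet_Ioo fun t ht => ?_
  have h := abs_deriv_mul_density ha ht
  simp only [smul_eq_mul, density, ← mul_assoc] at h ⊢
  rw [h]
  ring

/-- The density is unbounded near 0, but in the angular variable it becomes a continuous function on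
a compact interval. -/
theorem integrable_density {a : ℝ} (ha : a ∈ Ioo (0 : ℝ) 1) : Integrable (density a) := by
  have hb : 1 - a ∈ Ioo (0 : ℝ) 1 := ⟨by linarith [ha.2], by linarith [ha.1]⟩
  rw [← integrableOn_iff_integrable_of_support_subset (s := Ioo (0 : ℝ) 1)
    fun x hx => by_contra fun h => hx (density_eq_zero a h), ← halfCos_image,
    integrableOn_image_iff_integrableOn_abs_deriv_smul measurableSet_Ioo
      (fun t _ => (hasDerivAt_halfCos t).hasDerivWithinAt) halfCos_injOn]
  have h : IntegrableOn (fun t => Real.pi⁻¹ * szegoRe (1 - a) 0 t) (Ioo 0 Real.pi) :=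
    ((continuous_szegoRe hb 0).const_mul _ |>.integrableOn_Icc).mono_set Ioo_subset_Icc_self
  exact h.congr_fun (fun t ht => (abs_deriv_mul_density ha ht).symm) measurableSet_Ioo

/-- The probability measure with density `density a`. -/
def limitMeasure (a : ℝ) : Measure ℝ := volume.withDensity fun x => ENNReal.ofReal (density a x)

theorem integral_density {a : ℝ} (ha : a ∈ Ioo (0 : ℝ) 1) : ∫ x, density a x = 1 := by
  have hb : 1 - a ∈ Ioo (0 : ℝ) 1 := ⟨by linarith [ha.2], by linarith [ha.1]⟩
  have h := integral_density_mul ha fun _ => 1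
  simp only [mul_one, one_mul] at h
  rw [h, integral_szegoRe hb, if_pos rfl, inv_mul_cancel₀ Real.pi_pos.ne']

theorem isProbabilityMeasure_limitMeasure {a : ℝ} (ha : a ∈ Ioo (0 : ℝ) 1) :
    IsProbabilityMeasure (limitMeasure a) := by
  constructor
  rw [limitMeasure, withDensity_apply _ MeasurableSet.univ, Measure.restrict_univ,
    ← ofReal_integral_eq_lintegral_ofReal (integrable_density ha)
      (Filter.Eventually.of_forall (density_nonneg ha)), integral_density ha, ENNReal.ofReal_one]

theorem ae_limitMeasure_mem (a : ℝ) : ∀ᵐ x ∂(limitMeasure a), x ∈ Icc (-1 : ℝ) 1 := by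
  rw [limitMeasure, ae_withDensity_iff (measurable_density a).ennreal_ofReal]
  refine Filter.Eventually.of_forall fun x hx => ?_
  by_contra h
  refine hx ?_
  rw [density_eq_zero a fun h' => h ⟨by linarith [h'.1], h'.2.le⟩, ENNReal.ofReal_zero]

theorem integral_limitMeasure {a : ℝ} (ha : a ∈ Ioo (0 : ℝ) 1) (F : ℝ → ℝ) :
    ∫ x, F x ∂(limitMeasure a) = Real.pi⁻¹ * ∫ t in (0 : ℝ)..Real.pi,
      F (halfCos t) * szegoRe (1 - a) 0 t := by
  rw [← integral_density_mul ha, limitMeasure, integral_withDensity_eq_integral_toReal_smul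
    (measurable_density a).ennreal_ofReal (Filter.Eventually.of_forall fun x => by simp)]
  refine integral_congr_ae (Filter.Eventually.of_forall fun x => ?_)
  simp only [smul_eq_mul, ENNReal.toReal_ofReal (density_nonneg ha x)]

end Angular

/-! ### Matching the moments -/

/-- The moments of `Q(f)²` against the even vectors agree with those of the orthogonal
polynomials. -/
theorem inner_vacuum_pow_evenVec {a : ℝ} (haq : a = 1 + (q : ℝ))
    (ha : a ∈ Ioo (0 : ℝ) 1) {f : H} (hf : ‖f‖ = 1 / 2) (k m : ℕ) :
    inner ℂ (vacuum H q) (((field q f ^ 2) ^ k) (evenVec q f m)) =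
      ((Real.pi⁻¹ * ∫ t in (0 : ℝ)..Real.pi, halfCos t ^ k * szegoRe (1 - a) m t : ℝ) : ℂ) := by
  have hb : 1 - a ∈ Ioo (0 : ℝ) 1 := ⟨by linarith [ha.2], by linarith [ha.1]⟩
  have hq : ((q : ℝ) : ℂ) = a - 1 := by rw [haq]; push_cast; ring
  induction k generalizing m with
  | zero =>
    simp only [pow_zero, one_mul, one_apply_eq_self, inner_vacuum_evenVec,
      integral_szegoRe hb]
    split_ifs <;> simp [Real.pi_pos.ne']
  | succ k ih =>
    set I : ℕ → ℝ := fun m => ∫ t in (0 : ℝ)..Real.pi, halfCos t ^ k * szegoRe (1 - a) m t with hI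
    have hc : Continuous halfCos := by unfold halfCos; fun_prop
    have hi : ∀ m, IntervalIntegrable (fun t => halfCos t ^ k * szegoRe (1 - a) m t) volume 0
        Real.pi := fun m => ((hc.pow k).mul (continuous_szegoRe hb m)).intervalIntegrable _ _
    -- One factor `Q(f)²` is applied to the even vector first, which moves the index by at most one;
    -- the induction hypothesis for `k` is therefore needed at all indices, although only index 0 is
    -- used in the end.
    rw [pow_succ, mul_apply_eq_comp]
    match m with
    | 0 =>
      have hint : (∫ t in (0 : ℝ)..Real.pi, halfCos t ^ (k + 1) * szegoRe (1 - a) 0 t) =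
          4⁻¹ * (I 1 + I 0) := by
        rw [hI, ← intervalIntegral.integral_add (hi _) (hi _),
          ← intervalIntegral.integral_const_mul]
        refine intervalIntegral.integral_congr fun t _ => ?_
        have := halfCos_mul_szegoRe_zero hb t
        simp only [pow_succ]
        linear_combination (halfCos t ^ k / 4) * this
      rw [hint, sq_field_evenVec_zero q hf]
      simp only [map_smul, map_add, inner_smul_right, inner_add_right, ih]
      push_cast
      ring
    | 1 =>
      have hint : (∫ t in (0 : ℝ)..Real.pi, halfCos t ^ (k + 1) * szegoRe (1 - a) 1 t) =
          4⁻¹ * (I 2 + (1 + a) * I 1 + a * I 0) := by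
        rw [hI, ← intervalIntegral.integral_const_mul, ← intervalIntegral.integral_const_mul,
          ← intervalIntegral.integral_add (hi _) ((hi _).const_mul _),
          ← intervalIntegral.integral_add ((hi _).add ((hi _).const_mul _)) ((hi _).const_mul _),
          ← intervalIntegral.integral_const_mul]
        refine intervalIntegral.integral_congr fun t _ => ?_
        have := halfCos_mul_szegoRe_one hb t
        simp only [pow_succ]
        linear_combination (halfCos t ^ k / 4) * this
      rw [hint, sq_field_evenVec_one q hf]
      simp only [map_smul, map_add, inner_smul_right, inner_add_right, ih, hq]
      push_cast
      ring
    | m + 2 =>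
      have hint : (∫ t in (0 : ℝ)..Real.pi, halfCos t ^ (k + 1) * szegoRe (1 - a) (m + 2) t) =
          4⁻¹ * (I (m + 3) + 2 * I (m + 2) + I (m + 1)) := by
        rw [hI, ← intervalIntegral.integral_const_mul,
          ← intervalIntegral.integral_add (hi _) ((hi _).const_mul _),
          ← intervalIntegral.integral_add ((hi _).add ((hi _).const_mul _)) (hi _),
          ← intervalIntegral.integral_const_mul]
        refine intervalIntegral.integral_congr fun t _ => ?_
        have := halfCos_mul_szegoRe_add_two (1 - a) m t
        simp only [pow_succ]
        linear_combination (halfCos t ^ k / 4) * this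
      rw [hint, sq_field_evenVec_add_two q hf]
      simp only [map_smul, map_add, inner_smul_right, inner_add_right, ih]
      push_cast
      ring

theorem distribution_sq_field {a : ℝ} (haq : a = 1 + (q : ℝ))
    (ha : a ∈ Ioo (0 : ℝ) 1) {f : H} (hf : ‖f‖ = 1 / 2) :
    distribution (field q f ^ 2) (vacuum H q) = limitMeasure a := by
  have := isProbabilityMeasure_limitMeasure ha
  refine distribution_eq_of_moments ((isSelfAdjoint_field q f).pow 2) (norm_vacuum q)
    (ae_limitMeasure_mem a) fun k => ?_
  have h : evenVec q f 0 = vacuum H q := by simp [evenVec, powVec_zero]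
  have hk := inner_vacuum_pow_evenVec q haq ha hf k 0
  rw [h] at hk
  rw [integral_limitMeasure ha, hk]
  exact RCLike.ofReal_re _

end Q2Fock

end
open Q2Fock in
/-- For `q ∈ (-1, 0)`, `a = 1 + q` and `‖f‖ = 1/2`, the vacuum distribution of `Q(f)²` on the
`(q,2)`-Fock space is absolutely continuous with probability density `a / (8 π (1 - a)) g_a`. -/
theorem theorem3p3 {H : Type*} [NormedAddCommGroup H] [InnerProductSpace ℂ H] [CompleteSpace H]
    (q : Set.Icc (-1 : ℝ) 1) (a : ℝ) (haq : a = 1 + (q : ℝ)) (ha : a ∈ Set.Ioo (0 : ℝ) 1)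
    (f : H) (hf : ‖f‖ = 1 / 2) :
    (distribution (field q f ^ 2) (vacuum H q)).AbsolutelyContinuous MeasureTheory.volume ∧
    (∀ x : ℝ, 0 ≤ a / (8 * Real.pi * (1 - a)) * gFun a x) ∧
    (∫ x : ℝ, a / (8 * Real.pi * (1 - a)) * gFun a x) = 1 ∧
    distribution (field q f ^ 2) (vacuum H q) =
      MeasureTheory.volume.withDensity
        (fun x : ℝ => ENNReal.ofReal (a / (8 * Real.pi * (1 - a)) * gFun a x)) := by
  have h := distribution_sq_field q haq ha hf
  exact ⟨h ▸ MeasureTheory.withDensity_absolutelyContinuous _ _, density_nonneg ha,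
    integral_density ha, h⟩
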